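/- Let $F$ be a field of characteristic $2$ and let $n\ge 0$ be an integer. Let $\mathbb{B}_n$ be the group of all permutations $\sigma$ of $[-n,-1]\cup[1,n]$ with $\sigma(-i)=-\sigma(i)$ for all $i$, with Coxeter generators $s_0=(-1,1)$ and $s_i=(i,i+1)(-i,-(i+1))$ for $1\le i\le n-1$, and let $\ell$ be the corresponding length function. For $J\subseteq[0,n-1]$ put $X_J=\{w\in\mathbb{B}_n : \ell(ws_j)>\ell(w)\text{ for all }j\in J\}$ and $x_J=\sum_{w\in X_J}w\in F\mathbb{B}_n$, and let $A=\mathscr{D}_F(\mathbb{B}_n)$ be the descent algebra, that is, the subalgebra of the group algebra $F\mathbb{B}_n$ generated by the elements $x_J$ (by Solomon's theorem, it is their linear span). The Ext-quiver of $A$ is the quiver whose vertices are the isomorphism classes of simple left $A$-modules, with $\dim_F\mathsf{Ext}^1_A(S,T)$ arrows from $S$ to $T$. Then the Ext-quiver of $A$ has exactly one vertex, and it has at least $n$ loops at this vertex. Moreover, for every integer $m\ge 0$, the $m$-th power $\mathsf{Rad}^m(A)$ of the Jacobson radical of $A$ is contained in the $F$-linear span of the elements $x_J$ with $J\subseteq[0,n-1]$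 and $|J|\le n-m$. -/

import Mathlib

open CategoryTheory

universe u

noncomputable section

/-! ### Ext-quivers -/

/-- Isomorphism of simple left modules over a ring `A`. -/
def simpleModuleSetoid (A : Type u) [Ring A] :
    Setoid {M : ModuleCat.{u} A // IsSimpleModule A M} where
  r M N := Nonempty (M.1 ≃ₗ[A] N.1)
  iseqv :=
    ⟨fun _ => ⟨LinearEquiv.refl A _⟩, fun ⟨e⟩ => ⟨e.symm⟩, fun ⟨e⟩ ⟨f⟩ => ⟨e.trans f⟩⟩

/-- The vertices of the Ext-quiver of an `F`-algebra `A`: the isomorphism classes of simple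
left `A`-modules. -/
def ExtQuiver (F : Type u) [Field F] (A : Type u) [Ring A] [Algebra F A] : Type (u + 1) :=
  Quotient (simpleModuleSetoid A)

/-- A simple module in the isomorphism class `v`. -/
def ExtQuiver.simple {F : Type u} [Field F] {A : Type u} [Ring A] [Algebra F A]
    (v : ExtQuiver F A) : ModuleCat.{u} A :=
  (Quotient.out v).1

/-- The number of arrows from `v` to `w` in the Ext-quiver is `dim_F Ext¹_A(S_v, S_w)`. -/
instance ExtQuiver.instQuiver (F : Type u) [Field F] (A : Type u) [Ring A] [Algebra F A] :
    Quiver.{0} (ExtQuiver F A) where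
  Hom v w := Fin (Module.finrank F (Abelian.Ext.{u} v.simple w.simple 1))

/-! ### Descent algebras -/

/-- The length of `w` with respect to a family `s` generating a group: the least number of
factors in an expression of `w` as a product of members of the family. (The family is meant to
generate the group and to be closed under inverses, as for a Coxeter system.) -/
def wordLength {ι W : Type} [Group W] (s : ι → W) (w : W) : ℕ :=
  sInf {k | ∃ l : List ι, l.length = k ∧ (l.map s).prod = w}

/-- The distinguished (minimal length) representatives of the left cosets of the standard
parabolic subgroup `W_J`: `X_J = {w | ℓ(w s_j) > ℓ(w) for all j ∈ J}`. -/
def distinguishedReps {ι W : Type} [Group W] (s : ι → W) (J : Finset ι) : Set W :=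
  {w | ∀ j ∈ J, wordLength s w < wordLength s (w * s j)}

/-- The element `x_J = ∑_{w ∈ X_J} w` of the group algebra `F W`. -/
def descentElt (F : Type u) [Field F] {ι W : Type} [Group W] [Finite W] (s : ι → W)
    (J : Finset ι) : MonoidAlgebra F W :=
  ∑ w ∈ (Set.toFinite (distinguishedReps s J)).toFinset, MonoidAlgebra.of F W w

/-- The Solomon descent algebra of `(W, s)` over `F`, as the subalgebra of the group algebra
`F W` generated by the elements `x_J`. For a finite Coxeter system, Solomon's theorem says that
the linear span of the `x_J` is closed under multiplication, so that this is the span of the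
`x_J`. -/
def descentAlgebra (F : Type u) [Field F] {ι W : Type} [Group W] [Finite W] (s : ι → W) :
    Subalgebra F (MonoidAlgebra F W) :=
  Algebra.adjoin F (Set.range (descentElt F s))

/-! ### The Coxeter group of type `B` -/

/-- The set `[-n, -1] ∪ [1, n]` of integers. -/
abbrev SignedPoint (n : ℕ) : Type :=
  ((Finset.Icc (-(n : ℤ)) n).erase 0 : Finset ℤ)

/-- The permutation `i ↦ -i` of `[-n, -1] ∪ [1, n]`. -/
def negPerm (n : ℕ) : Equiv.Perm (SignedPoint n) :=
  Function.Involutive.toPerm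
    (fun i => ⟨-i.1, by
      have h := i.2
      simp only [Finset.mem_erase, Finset.mem_Icc] at h ⊢
      omega⟩)
    (fun i => Subtype.ext (neg_neg i.1))

/-- The hyperoctahedral group `B_n`: the permutations `σ` of `[-n, -1] ∪ [1, n]` such that
`σ (-i) = -σ i` for all `i`. -/
abbrev HyperoctahedralGroup (n : ℕ) : Type :=
  Subgroup.centralizer {negPerm n}

/-- For `k < n`, the point `k + 1` of `[1, n]`. -/
def posPoint {n : ℕ} (k : Fin n) : SignedPoint n :=
  ⟨(k : ℤ) + 1, by
    have h := k.2
    simp only [Finset.mem_erase, Finset.mem_Icc]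
    omega⟩

/-- For `k < n`, the point `-(k + 1)` of `[-n, -1]`. -/
def negPoint {n : ℕ} (k : Fin n) : SignedPoint n :=
  negPerm n (posPoint k)

/-- The underlying permutations of the Coxeter generators: `s_0 = (-1, 1)`, and
`s_i = (i, i+1)(-i, -(i+1))` for `1 ≤ i ≤ n - 1`. -/
def simplePermB {n : ℕ} (i : Fin n) : Equiv.Perm (SignedPoint n) :=
  if i.1 = 0 then Equiv.swap (negPoint i) (posPoint i)
  else
    Equiv.swap (posPoint ⟨i.1 - 1, lt_of_le_of_lt (Nat.sub_le _ _) i.2⟩) (posPoint i) *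
      Equiv.swap (negPoint ⟨i.1 - 1, lt_of_le_of_lt (Nat.sub_le _ _) i.2⟩) (negPoint i)

theorem simplePermB_mem {n : ℕ} (i : Fin n) :
    simplePermB i ∈ Subgroup.centralizer {negPerm n} := by
  have hneg : ∀ k : Fin n, negPerm n (negPoint k) = posPoint k := fun k =>
    Subtype.ext (neg_neg _)
  have hpos : ∀ k : Fin n, negPerm n (posPoint k) = negPoint k := fun _ => rfl
  have hne : ∀ k l : Fin n, posPoint k ≠ negPoint l := by
    intro k l h
    have h' : ((k : ℤ) + 1) = -((l : ℤ) + 1) := congrArg Subtype.val h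
    omega
  have hswap : ∀ a b : SignedPoint n, negPerm n * Equiv.swap a b =
      Equiv.swap (negPerm n a) (negPerm n b) * negPerm n := fun a b =>
    Equiv.mul_swap_eq_swap_mul _ a b
  rw [Subgroup.mem_centralizer_singleton_iff]
  unfold simplePermB
  split_ifs with h
  · rw [hswap, hneg, hpos, Equiv.swap_comm]
  · rw [← mul_assoc (negPerm n), hswap, mul_assoc _ (negPerm n), hswap, hneg, hneg, hpos, hpos, ← mul_assoc]
    congr 1
    generalize (⟨i.1 - 1, _⟩ : Fin n) = a
    refine Equiv.Perm.Disjoint.commute ?_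
    intro x
    by_cases hx : x = posPoint a ∨ x = posPoint i
    · right
      apply Equiv.swap_apply_of_ne_of_ne <;> rcases hx with rfl | rfl <;> apply hne
    · left
      push Not at hx
      exact Equiv.swap_apply_of_ne_of_ne hx.1 hx.2

/-- The Coxeter generators `s_0, …, s_{n-1}` of the hyperoctahedral group, indexed by
`[0, n-1]`. -/
def simpleB (n : ℕ) (i : Fin n) : HyperoctahedralGroup n :=
  ⟨simplePermB i, simplePermB_mem i⟩

/-- The descent algebra of the Coxeter group of type `B_n` over `F`. -/
abbrev descentAlgebraB (F : Type u) [Field F] (n : ℕ) :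
    Subalgebra F (MonoidAlgebra F (HyperoctahedralGroup n)) :=
  descentAlgebra F (simpleB n)

end

/-!
The descent algebra is the algebra of invariants of the face semigroup of the reflection
arrangement, with the multiplication reversed (Bidigare). In concrete terms, let a face of type `K`
be a translate of the standard face stabilized by the parabolic subgroup of type `K`. Then
`x_K x_J` is the sum, over the faces `G` of type `K` whose product with the standard face of type
`J` lies in the fundamental chamber, of `x_L`, where `L ⊆ J` is the type of this product
(`descentElt_mul`). Faces are encoded as odd functions on `[-n, -1] ∪ [1, n]`, and the proof of
the rule is the factorization `u = y w` of an element into a distinguished coset representative `y`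
and an element `w` of a given coset of a parabolic subgroup. The translation between lengths and
ascents of signed permutations (`mem_distinguishedReps_iff`) comes from the exchange condition.

The term `L = J` arises exactly from the faces `G` contained in the span of the standard face of
type `J`. Since `-1` belongs to the group, `G ↦ -G` permutes these faces of type `K`, and without
fixed points if `K` is proper. So in characteristic `2` the coefficient of `x_J` in `x_K x_J`
vanishes for proper `K` (`sum_compatibleFaces_flat_eq_zero`). Writing `V_m` for the span of the
`x_J` with `|J| ≤ n - m`, this gives `V_1 V_m ⊆ V_{m+1}` (`descentFiltration_one_mul`). As
`V_{n+1} = 0` and `V_0 = F + V_1`, the ideal `V_1` is nil of codimension one, hence the only maximal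
left ideal. It follows that there is one simple module `S`, and that the `m`-th power of the radical
lies in `V_m`.

Finally, applying `Hom(-, S)` to `0 → V_1 → A → S → 0` identifies `Ext¹(S, S)` with `Hom_A(V_1, S)`,
which contains the functionals on `V_1 / V_2` (`card_le_finrank_ext`). The `n` elements `x_J` with
`|J| = n - 1` are independent modulo `V_2` by `linearIndependent_descentElt`.
-/

/-! ### Steps, ascents and descents -/

/-- The upper end `j + 1` of the `j`-th step of `[-n, -1] ∪ [1, n]`. -/
def stepTop {n : ℕ} (j : Fin n) : SignedPoint n := posPoint j

/-- The lower end of the `j`-th step of `[-n, -1] ∪ [1, n]`: the predecessor of `j + 1`, which is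
`-1` for `j = 0` and `j` otherwise. -/
def stepBot {n : ℕ} (j : Fin n) : SignedPoint n :=
  if j.1 = 0 then negPoint j else posPoint ⟨j.1 - 1, lt_of_le_of_lt (Nat.sub_le _ _) j.2⟩

section Points

variable {n : ℕ}

@[simp]
theorem negPerm_val (x : SignedPoint n) : (negPerm n x).1 = -x.1 := rfl

@[simp]
theorem negPerm_negPerm (x : SignedPoint n) : negPerm n (negPerm n x) = x :=
  Subtype.ext (neg_neg _)

theorem signedPoint_mem (x : SignedPoint n) : x.1 ≠ 0 ∧ -(n : ℤ) ≤ x.1 ∧ x.1 ≤ n := by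
  have h := x.2
  simpa only [Finset.mem_erase, Finset.mem_Icc] using h

theorem stepTop_val (j : Fin n) : (stepTop j).1 = j.1 + 1 := rfl

theorem stepBot_val (j : Fin n) : (stepBot j).1 = if j.1 = 0 then -1 else (j.1 : ℤ) := by
  unfold stepBot
  split_ifs with h
  · simp [negPoint, posPoint, h]
  · simp only [posPoint]
    omega

theorem stepBot_lt_stepTop (j : Fin n) : stepBot j < stepTop j := by
  rw [← Subtype.coe_lt_coe, stepBot_val, stepTop_val]
  split_ifs <;> omega

theorem hyperoctahedral_neg (w : HyperoctahedralGroup n) (x : SignedPoint n) :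
    w.1 (negPerm n x) = negPerm n (w.1 x) := by
  have h := Subgroup.mem_centralizer_singleton_iff.mp w.2
  exact (congrArg (fun σ : Equiv.Perm (SignedPoint n) => σ x) h)

theorem simpleB_apply_val (j : Fin n) (x : SignedPoint n) :
    ((simpleB n j).1 x).1 =
      if x.1 = (stepBot j).1 then (stepTop j).1
      else if x.1 = (stepTop j).1 then (stepBot j).1
      else if x.1 = -(stepBot j).1 then -(stepTop j).1
      else if x.1 = -(stepTop j).1 then -(stepBot j).1
      else x.1 := by
  have hj := j.2
  rw [stepBot_val, stepTop_val]
  by_cases h : j.1 = 0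
  · simp only [simpleB, simplePermB, h, if_true, Equiv.swap_apply_def, Subtype.ext_iff]
    have h1 : (posPoint j).1 = 1 := by simp [posPoint, h]
    have h2 : (negPoint j).1 = -1 := by simp [negPoint, posPoint, h]
    split_ifs <;> simp_all
  · simp only [simpleB, simplePermB, h, if_false, Equiv.swap_apply_def, Subtype.ext_iff,
      Equiv.Perm.mul_apply]
    generalize hk : (⟨j.1 - 1, _⟩ : Fin n) = k
    have hk' : k.1 = j.1 - 1 := by rw [← hk]
    have h1 : (posPoint j).1 = j.1 + 1 := rfl
    have h2 : (negPoint j).1 = -(j.1 + 1) := rfl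
    have h3 : (posPoint k).1 = j.1 := by simp only [posPoint]; omega
    have h4 : (negPoint k).1 = -j.1 := by simp only [negPoint, negPerm_val, posPoint]; omega
    split_ifs <;> omega

@[simp]
theorem simpleB_stepBot (j : Fin n) : (simpleB n j).1 (stepBot j) = stepTop j := by
  apply Subtype.ext
  rw [simpleB_apply_val, if_pos rfl]

@[simp]
theorem simpleB_stepTop (j : Fin n) : (simpleB n j).1 (stepTop j) = stepBot j := by
  have h := stepBot_lt_stepTop j
  rw [← Subtype.coe_lt_coe] at h
  apply Subtype.ext
  rw [simpleB_apply_val, if_neg h.ne', if_pos rfl]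

theorem simpleB_apply_of_ne {j : Fin n} {x : SignedPoint n} (h1 : x ≠ stepBot j)
    (h2 : x ≠ stepTop j) (h3 : x ≠ negPerm n (stepBot j)) (h4 : x ≠ negPerm n (stepTop j)) :
    (simpleB n j).1 x = x := by
  apply Subtype.ext
  simp only [Ne, Subtype.ext_iff, negPerm_val] at h1 h2 h3 h4
  rw [simpleB_apply_val, if_neg h1, if_neg h2, if_neg h3, if_neg h4]

/-- A property of points that is stable under negation may be checked at the ends of the `j`-th
step and at the points that are not ends of this step or of its negative. -/
theorem step_cases (j : Fin n) {p : SignedPoint n → Prop} (hneg : ∀ x, p x → p (negPerm n x))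
    (h1 : p (stepBot j)) (h2 : p (stepTop j))
    (h : ∀ x, x ≠ stepBot j → x ≠ stepTop j → x ≠ negPerm n (stepBot j) →
      x ≠ negPerm n (stepTop j) → p x) (x : SignedPoint n) : p x := by
  by_cases e1 : x = stepBot j
  · exact e1 ▸ h1
  by_cases e2 : x = stepTop j
  · exact e2 ▸ h2
  by_cases e3 : x = negPerm n (stepBot j)
  · exact e3 ▸ hneg _ h1
  by_cases e4 : x = negPerm n (stepTop j)
  · exact e4 ▸ hneg _ h2
  exact h x e1 e2 e3 e4

theorem simpleB_mul_self (j : Fin n) : simpleB n j * simpleB n j = 1 := by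
  apply Subtype.ext
  ext1 x
  change (simpleB n j).1 ((simpleB n j).1 x) = x
  refine step_cases (p := fun x => (simpleB n j).1 ((simpleB n j).1 x) = x) j
    (fun x hx => ?_) (by simp) (by simp) (fun x h1 h2 h3 h4 => ?_) x
  · rw [hyperoctahedral_neg, hyperoctahedral_neg, hx]
  · rw [simpleB_apply_of_ne h1 h2 h3 h4, simpleB_apply_of_ne h1 h2 h3 h4]

/-- A generator reverses the order of two points only if they are the ends of its step, or the
negatives of these. -/
theorem simpleB_lt_or {i : Fin n} {a b : SignedPoint n} (hab : a < b) :
    (simpleB n i).1 a < (simpleB n i).1 b ∨ (a = stepBot i ∧ b = stepTop i) ∨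
      (a = negPerm n (stepTop i) ∧ b = negPerm n (stepBot i)) := by
  have ha := signedPoint_mem a
  have hb := signedPoint_mem b
  simp only [← Subtype.coe_lt_coe, Subtype.ext_iff, negPerm_val, simpleB_apply_val, stepBot_val,
    stepTop_val] at hab ⊢
  have hi : 0 ≤ (i.1 : ℤ) := by omega
  generalize hm : (if i.1 = 0 then -1 else (i.1 : ℤ)) = m
  have hm' : (i.1 = 0 ∧ m = -1) ∨ (0 < i.1 ∧ m = i.1) := by
    split_ifs at hm <;> omega
  split_ifs <;> omega

theorem hyperoctahedral_lt_iff_neg (w : HyperoctahedralGroup n) (a b : SignedPoint n) :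
    w.1 (negPerm n a) < w.1 (negPerm n b) ↔ w.1 b < w.1 a := by
  rw [hyperoctahedral_neg, hyperoctahedral_neg, ← Subtype.coe_lt_coe, ← Subtype.coe_lt_coe,
    negPerm_val, negPerm_val, neg_lt_neg_iff]

/-- The conjugate of a generator by an element matching two steps is again a generator. -/
theorem simpleB_mul_eq_mul_simpleB {v : HyperoctahedralGroup n} {i j : Fin n}
    (h : (v.1 (stepBot j) = stepBot i ∧ v.1 (stepTop j) = stepTop i) ∨
      (v.1 (stepBot j) = negPerm n (stepTop i) ∧ v.1 (stepTop j) = negPerm n (stepBot i))) :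
    simpleB n i * v = v * simpleB n j := by
  apply Subtype.ext
  ext1 x
  change (simpleB n i).1 (v.1 x) = v.1 ((simpleB n j).1 x)
  have hv : ∀ y z, v.1 y = v.1 z ↔ y = z := fun y z => v.1.injective.eq_iff
  refine step_cases (p := fun x => (simpleB n i).1 (v.1 x) = v.1 ((simpleB n j).1 x)) j
    (fun x hx => ?_) ?_ ?_ (fun x h1 h2 h3 h4 => ?_) x
  · simp only [hyperoctahedral_neg, hx]
  · rcases h with h | h <;> simp [h, hyperoctahedral_neg]
  · rcases h with h | h <;> simp [h, hyperoctahedral_neg]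
  · rw [simpleB_apply_of_ne h1 h2 h3 h4]
    rw [Ne, ← hv] at h1 h2
    rw [Ne, ← hv, hyperoctahedral_neg] at h3 h4
    rcases h with ⟨e1, e2⟩ | ⟨e1, e2⟩ <;> rw [e1] at h1 h3 <;> rw [e2] at h2 h4
    · exact simpleB_apply_of_ne h1 h2 h3 h4
    · rw [negPerm_negPerm] at h3 h4
      exact simpleB_apply_of_ne h4 h3 h2 h1

theorem simpleB_mul_self_assoc (w : HyperoctahedralGroup n) (j : Fin n) :
    w * simpleB n j * simpleB n j = w := by
  rw [mul_assoc, simpleB_mul_self, mul_one]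

/-! ### The length function -/

/-- The exchange condition: if `w` reverses the `j`-th step, then `w s_j` is obtained from any
word for `w` by deleting a letter. -/
theorem exists_word_of_descent (j : Fin n) (l : List (Fin n))
    (h : (l.map (simpleB n)).prod.1 (stepTop j) < (l.map (simpleB n)).prod.1 (stepBot j)) :
    ∃ l' : List (Fin n), l'.length + 1 = l.length ∧
      (l'.map (simpleB n)).prod = (l.map (simpleB n)).prod * simpleB n j := by
  induction l with
  | nil => exact absurd h (stepBot_lt_stepTop j).not_gt
  | cons i l ih =>
    simp only [List.map_cons, List.prod_cons] at h ⊢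
    set v := (l.map (simpleB n)).prod
    rcases lt_trichotomy (v.1 (stepTop j)) (v.1 (stepBot j)) with hv | hv | hv
    · obtain ⟨l', hl', e⟩ := ih hv
      exact ⟨i :: l', by simp [hl'], by simp [e, mul_assoc]⟩
    · exact absurd (v.1.injective hv) (stepBot_lt_stepTop j).ne'
    · refine ⟨l, rfl, ?_⟩
      rw [simpleB_mul_eq_mul_simpleB ((simpleB_lt_or hv).resolve_left h.not_gt),
        simpleB_mul_self_assoc]

/-- An odd function increasing along the `n` steps is increasing: oddness takes care of the points
below `-1`. -/
theorem strictMono_of_steps {h : SignedPoint n → ℤ} (hodd : ∀ x, h (negPerm n x) = -h x)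
    (hstep : ∀ j : Fin n, h (stepBot j) < h (stepTop j)) : StrictMono h := by
  have key : ∀ k : ℕ, ∀ a b : SignedPoint n, b.1 = (k : ℤ) + 1 → -b.1 ≤ a.1 → a < b →
      h a < h b := by
    intro k
    induction k with
    | zero =>
      intro a b hb hab hlt
      rw [← Subtype.coe_lt_coe] at hlt
      have ha := signedPoint_mem a
      have hb' := signedPoint_mem b
      have hs := hstep ⟨0, by omega⟩
      convert hs using 2
      · apply Subtype.ext; rw [stepBot_val]; simp; omega
      · apply Subtype.ext; rw [stepTop_val]; simp; omega
    | succ k ih =>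
      intro a b hb hab hlt
      rw [← Subtype.coe_lt_coe] at hlt
      have ha := signedPoint_mem a
      have hb' := signedPoint_mem b
      have hk : k + 1 < n := by omega
      have hs := hstep ⟨k + 1, hk⟩
      have et : stepTop ⟨k + 1, hk⟩ = b := by
        apply Subtype.ext; rw [stepTop_val]; simp; omega
      have eb : (stepBot ⟨k + 1, hk⟩ : SignedPoint n).1 = (k : ℤ) + 1 := by
        rw [stepBot_val]; simp
      rw [et] at hs
      set c := (stepBot ⟨k + 1, hk⟩ : SignedPoint n)
      by_cases e1 : a.1 = k + 1
      · rwa [show a = c from Subtype.ext (by omega)]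
      by_cases e2 : a.1 = -b.1
      · rw [show a = negPerm n b from Subtype.ext e2, hodd]
        have h3 := ih (negPerm n c) c eb (by simp) (by
          rw [← Subtype.coe_lt_coe, negPerm_val]; omega)
        rw [hodd] at h3
        omega
      · exact (ih a c eb (by omega) (by rw [← Subtype.coe_lt_coe]; omega)).trans hs
  intro a b hab
  have hab' := Subtype.coe_lt_coe.mpr hab
  have ha := signedPoint_mem a
  have hb := signedPoint_mem b
  by_cases hc : -b.1 ≤ a.1
  · exact key (b.1.toNat - 1) a b (by omega) hc hab
  · have h1 := key ((-a.1).toNat - 1) (negPerm n b) (negPerm n a) (by rw [negPerm_val]; omega)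
      (by rw [negPerm_val, negPerm_val]; omega)
      (by rw [← Subtype.coe_lt_coe, negPerm_val, negPerm_val]; omega)
    rw [hodd, hodd] at h1
    omega

theorem hyperoctahedral_eq_one_of_strictMono {w : HyperoctahedralGroup n}
    (h : StrictMono w.1) : w = 1 := by
  have h2 : StrictMono.orderIsoOfSurjective w.1 h w.1.surjective = OrderIso.refl _ :=
    Subsingleton.elim _ _
  apply Subtype.ext
  ext1 x
  exact congrArg (fun f : SignedPoint n ≃o SignedPoint n => f x) h2

theorem eq_one_of_forall_ascent {w : HyperoctahedralGroup n}
    (h : ∀ j : Fin n, w.1 (stepBot j) < w.1 (stepTop j)) : w = 1 := by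
  apply hyperoctahedral_eq_one_of_strictMono
  have := strictMono_of_steps (h := fun x => (w.1 x).1)
    (fun x => by rw [hyperoctahedral_neg, negPerm_val]) (fun j => h j)
  exact fun a b hab => this hab

/-- The pairs of points whose order is reversed by `w`. -/
noncomputable def inversionsB (w : HyperoctahedralGroup n) :
    Finset (SignedPoint n × SignedPoint n) :=
  Finset.univ.filter fun p => p.1 < p.2 ∧ w.1 p.2 < w.1 p.1

/-- For a descent `j` of `w`, the generator `s_j` maps the inversions of `w s_j` into those of `w`,
missing the `j`-th step. -/
theorem card_inversionsB_mul_lt {w : HyperoctahedralGroup n} {j : Fin n}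
    (h : w.1 (stepTop j) < w.1 (stepBot j)) :
    (inversionsB (w * simpleB n j)).card < (inversionsB w).card := by
  have hs : ∀ x, (w * simpleB n j).1 x = w.1 ((simpleB n j).1 x) := fun _ => rfl
  rw [← Finset.card_map ((simpleB n j).1.prodCongr (simpleB n j).1).toEmbedding]
  apply Finset.card_lt_card
  rw [Finset.ssubset_iff_of_subset]
  · refine ⟨(stepBot j, stepTop j), by simp [inversionsB, stepBot_lt_stepTop, h], ?_⟩
    intro hmem
    obtain ⟨⟨a, b⟩, hp, e⟩ := Finset.mem_map.mp hmem
    simp only [inversionsB, Finset.mem_filter, Finset.mem_univ, true_and, hs] at hp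
    simp only [Equiv.coe_toEmbedding, Equiv.prodCongr_apply, Prod.map_apply, Prod.mk.injEq] at e
    have ea : a = stepTop j := (simpleB n j).1.injective (by rw [e.1, simpleB_stepTop])
    have eb : b = stepBot j := (simpleB n j).1.injective (by rw [e.2, simpleB_stepBot])
    rw [ea, eb] at hp
    exact hp.1.not_gt (stepBot_lt_stepTop j)
  · intro p hp'
    obtain ⟨⟨a, b⟩, hp, rfl⟩ := Finset.mem_map.mp hp'
    simp only [inversionsB, Finset.mem_filter, Finset.mem_univ, true_and, hs] at hp
    simp only [Equiv.coe_toEmbedding, Equiv.prodCongr_apply, Prod.map_apply, inversionsB,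
      Finset.mem_filter, Finset.mem_univ, true_and]
    refine ⟨(simpleB_lt_or hp.1).resolve_right ?_, hp.2⟩
    rintro (⟨rfl, rfl⟩ | ⟨rfl, rfl⟩)
    · simp only [simpleB_stepBot, simpleB_stepTop] at hp
      exact hp.2.not_gt h
    · simp only [hyperoctahedral_neg, simpleB_stepBot, simpleB_stepTop] at hp
      have := hp.2
      rw [← hyperoctahedral_neg, ← hyperoctahedral_neg, hyperoctahedral_lt_iff_neg] at this
      exact this.not_gt h

/-- The elements `s_0, …, s_{n-1}` generate the hyperoctahedral group. -/
theorem exists_word (w : HyperoctahedralGroup n) :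
    ∃ l : List (Fin n), (l.map (simpleB n)).prod = w := by
  induction hk : (inversionsB w).card using Nat.strong_induction_on generalizing w with
  | _ k ih =>
    by_cases h : ∃ j : Fin n, w.1 (stepTop j) < w.1 (stepBot j)
    · obtain ⟨j, hj⟩ := h
      obtain ⟨l, hl⟩ := ih _ (hk ▸ card_inversionsB_mul_lt hj) _ rfl
      exact ⟨l ++ [j], by simp [hl, simpleB_mul_self_assoc]⟩
    · push Not at h
      refine ⟨[], (eq_one_of_forall_ascent fun j => (h j).lt_of_ne fun e => ?_).symm⟩
      exact (stepBot_lt_stepTop j).ne (w.1.injective e)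

theorem wordLength_mul_lt_of_descent {w : HyperoctahedralGroup n} {j : Fin n}
    (h : w.1 (stepTop j) < w.1 (stepBot j)) :
    wordLength (simpleB n) (w * simpleB n j) < wordLength (simpleB n) w := by
  -- Without a word for `w`, the infimum defining its length would be a junk value.
  have hne : {k | ∃ l : List (Fin n), l.length = k ∧ (l.map (simpleB n)).prod = w}.Nonempty := by
    obtain ⟨l, hl⟩ := exists_word w
    exact ⟨_, l, rfl, hl⟩
  obtain ⟨l, hl, e⟩ := Nat.sInf_mem hne
  change l.length = wordLength (simpleB n) w at hl
  rw [← e] at h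
  obtain ⟨l', hl', e'⟩ := exists_word_of_descent j l h
  rw [← hl, ← hl']
  refine Nat.lt_succ_of_le (Nat.sInf_le ⟨l', rfl, ?_⟩)
  rw [e', e]

theorem wordLength_lt_mul_iff {w : HyperoctahedralGroup n} {j : Fin n} :
    wordLength (simpleB n) w < wordLength (simpleB n) (w * simpleB n j) ↔
      w.1 (stepBot j) < w.1 (stepTop j) := by
  constructor
  · intro h
    by_contra hc
    refine h.not_gt (wordLength_mul_lt_of_descent ((not_lt.mp hc).lt_of_ne fun e => ?_))
    exact (stepBot_lt_stepTop j).ne' (w.1.injective e)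
  · intro h
    have h2 := wordLength_mul_lt_of_descent (w := w * simpleB n j) (j := j) (by
      change w.1 ((simpleB n j).1 _) < w.1 ((simpleB n j).1 _)
      simpa using h)
    rwa [simpleB_mul_self_assoc] at h2

/-- In terms of permutations, `X_J` consists of the `w` that increase along the steps in `J`. -/
theorem mem_distinguishedReps_iff {w : HyperoctahedralGroup n} {J : Finset (Fin n)} :
    w ∈ distinguishedReps (simpleB n) J ↔ ∀ j ∈ J, w.1 (stepBot j) < w.1 (stepTop j) :=
  forall₂_congr fun _ _ => wordLength_lt_mul_iff

end Points

/-! ### Faces and the multiplication rule -/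

section Faces

variable {n : ℕ}

/-- The standard face of type `K`, encoded as an odd function on `[-n, -1] ∪ [1, n]` which is
constant along the steps in `K` and increases along the others: a point in the relative interior of
the face of the fundamental chamber whose stabilizer is the standard parabolic subgroup generated by
the `s_j` with `j ∈ K`. -/
def standardFace (K : Finset (Fin n)) (x : SignedPoint n) : ℤ :=
  ((Finset.univ.filter fun j : Fin n => j ∉ K ∧ (j.1 : ℤ) + 1 ≤ x.1).card : ℤ) -
    ((Finset.univ.filter fun j : Fin n => j ∉ K ∧ (j.1 : ℤ) + 1 ≤ -x.1).card : ℤ)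

theorem standardFace_neg (K : Finset (Fin n)) (x : SignedPoint n) :
    standardFace K (negPerm n x) = -standardFace K x := by
  simp [standardFace]

theorem standardFace_monotone (K : Finset (Fin n)) : Monotone (standardFace K) := by
  intro a b hab
  rw [← Subtype.coe_le_coe] at hab
  refine sub_le_sub ?_ ?_ <;> refine Nat.cast_le.mpr (Finset.card_le_card fun j hj => ?_) <;>
    simp only [Finset.mem_filter, Finset.mem_univ, true_and] at hj ⊢ <;>
    exact ⟨hj.1, by omega⟩

theorem standardFace_stepBot_eq {K : Finset (Fin n)} {j : Fin n} (hj : j ∈ K) :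
    standardFace K (stepBot j) = standardFace K (stepTop j) := by
  unfold standardFace
  rw [stepBot_val, stepTop_val]
  congr 3 <;> refine Finset.filter_congr fun i _ => and_congr_right fun hi => ?_ <;>
    have hij : i.1 ≠ j.1 := fun e => hi (Fin.ext e ▸ hj) <;> split_ifs <;> omega

theorem standardFace_stepBot_lt {K : Finset (Fin n)} {j : Fin n} (hj : j ∉ K) :
    standardFace K (stepBot j) < standardFace K (stepTop j) := by
  refine (sub_lt_sub_right ?_ _).trans_le (sub_le_sub_left ?_ _)
  · refine Nat.cast_lt.mpr (Finset.card_lt_card ((Finset.ssubset_iff_of_subset fun i hi => ?_).mpr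
      ⟨j, by simp [hj, stepTop_val], fun hi => ?_⟩))
    · rw [Finset.mem_filter, stepBot_val] at hi
      rw [Finset.mem_filter, stepTop_val]
      exact ⟨hi.1, hi.2.1, by have := hi.2.2; split_ifs at this <;> omega⟩
    · rw [Finset.mem_filter, stepBot_val] at hi
      have := hi.2.2
      split_ifs at this <;> omega
  · refine Nat.cast_le.mpr (Finset.card_le_card fun i hi => ?_)
    rw [Finset.mem_filter, stepTop_val] at hi
    rw [Finset.mem_filter, stepBot_val]
    exact ⟨hi.1, hi.2.1, by have := hi.2.2; split_ifs <;> omega⟩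

theorem standardFace_simpleB {K : Finset (Fin n)} {j : Fin n} (hj : j ∈ K)
    (x : SignedPoint n) : standardFace K ((simpleB n j).1 x) = standardFace K x := by
  refine step_cases (p := fun x => standardFace K ((simpleB n j).1 x) = standardFace K x) j
    (fun x hx => ?_) ?_ ?_ (fun x h1 h2 h3 h4 => ?_) x
  · rw [hyperoctahedral_neg, standardFace_neg, standardFace_neg, hx]
  · rw [simpleB_stepBot, standardFace_stepBot_eq hj]
  · rw [simpleB_stepTop, standardFace_stepBot_eq hj]
  · rw [simpleB_apply_of_ne h1 h2 h3 h4]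

/-- An element increasing along the steps in `K` increases on each set of points where the standard
face of type `K` is constant. -/
theorem lt_of_standardFace_eq {K : Finset (Fin n)} {y : HyperoctahedralGroup n}
    (hy : ∀ j ∈ K, y.1 (stepBot j) < y.1 (stepTop j)) {a b : SignedPoint n} (hab : a < b)
    (h : standardFace K a = standardFace K b) : y.1 a < y.1 b := by
  -- The values of `y` differ by at most `2 n`, so this sum orders points by the face first.
  have hmono := strictMono_of_steps
    (h := fun x => (2 * (n : ℤ) + 1) * standardFace K x + (y.1 x).1)
    (fun x => by rw [standardFace_neg, hyperoctahedral_neg, negPerm_val]; ring) (fun j => by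
      by_cases hj : j ∈ K
      · have := Subtype.coe_lt_coe.mpr (hy j hj)
        rw [standardFace_stepBot_eq hj]
        omega
      · have h1 := standardFace_stepBot_lt hj
        have h2 := signedPoint_mem (y.1 (stepBot j))
        have h3 := signedPoint_mem (y.1 (stepTop j))
        nlinarith)
  have := hmono hab
  simp only [h, add_lt_add_iff_left] at this
  exact Subtype.coe_lt_coe.mp this

/-- The faces of type `K`: the translates of the standard face of type `K`. As functions, the faces
of type `K` correspond to the cosets `W_K v`, where `W_K` is the stabilizer of the standard face. -/
noncomputable def facesOfType (K : Finset (Fin n)) : Finset (SignedPoint n → ℤ) :=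
  (Set.finite_range fun v : HyperoctahedralGroup n => standardFace K ∘ v.1).toFinset

theorem mem_facesOfType {K : Finset (Fin n)} {g : SignedPoint n → ℤ} :
    g ∈ facesOfType K ↔ ∃ v : HyperoctahedralGroup n, standardFace K ∘ v.1 = g := by
  simp [facesOfType]

/-- The faces of type `K` that do not decrease along the steps in `J`, that is, whose product with
the standard face of type `J` is again a face of the fundamental chamber. -/
noncomputable def compatibleFaces (K J : Finset (Fin n)) : Finset (SignedPoint n → ℤ) :=
  (facesOfType K).filter fun g => ∀ j ∈ J, g (stepBot j) ≤ g (stepTop j)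

/-- The steps in `J` along which `g` is constant. If `g` is a compatible face, this is the type of
the product of the standard face of type `J` with `g`. -/
def flatSteps (J : Finset (Fin n)) (g : SignedPoint n → ℤ) : Finset (Fin n) :=
  J.filter fun j => g (stepBot j) = g (stepTop j)

theorem flatSteps_subset (J : Finset (Fin n)) (g : SignedPoint n → ℤ) : flatSteps J g ⊆ J :=
  Finset.filter_subset _ _

theorem mem_toFinset_distinguishedReps {w : HyperoctahedralGroup n} {J : Finset (Fin n)} :
    w ∈ (Set.toFinite (distinguishedReps (simpleB n) J)).toFinset ↔
      ∀ j ∈ J, w.1 (stepBot j) < w.1 (stepTop j) := by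
  rw [Set.Finite.mem_toFinset, mem_distinguishedReps_iff]

/-- Uniqueness of the factorization `u = y w` with `y` increasing along the steps in `K` and `w` in
a given coset `W_K v`; equality of these cosets is equality of the faces. -/
theorem eq_of_standardFace_comp_eq {K : Finset (Fin n)} {y y' w w' : HyperoctahedralGroup n}
    (hy : ∀ j ∈ K, y.1 (stepBot j) < y.1 (stepTop j))
    (hy' : ∀ j ∈ K, y'.1 (stepBot j) < y'.1 (stepTop j))
    (hw : standardFace K ∘ w.1 = standardFace K ∘ w'.1) (h : y * w = y' * w') :
    y = y' ∧ w = w' := by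
  have hz : ∀ x, standardFace K ((w' * w⁻¹).1 x) = standardFace K x := fun x => by
    have := congrFun hw (w.1.symm x)
    simp only [Function.comp_apply, Equiv.apply_symm_apply] at this
    exact this.symm
  have hyz : y = y' * (w' * w⁻¹) := by rw [← mul_assoc, ← h, mul_inv_cancel_right]
  have hyx : ∀ x, y.1 x = y'.1 ((w' * w⁻¹).1 x) := fun x => by
    conv_lhs => rw [hyz]
    rfl
  have h1 : w' * w⁻¹ = 1 := by
    apply hyperoctahedral_eq_one_of_strictMono
    intro a b hab
    by_contra hc
    have hba := (not_lt.mp hc).lt_of_ne fun e => hab.ne' ((w' * w⁻¹).1.injective e)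
    have hf : standardFace K a = standardFace K b := by
      refine le_antisymm (standardFace_monotone K hab.le) ?_
      rw [← hz a, ← hz b]
      exact standardFace_monotone K hba.le
    have h2 := lt_of_standardFace_eq hy hab hf
    rw [hyx, hyx] at h2
    exact h2.not_gt (lt_of_standardFace_eq hy' hba (by rw [hz, hz, hf]))
  rw [h1, mul_one] at hyz
  exact ⟨hyz, (mul_inv_eq_one.mp h1).symm⟩

/-- Existence of the factorization `u = y w` with `y` increasing along the steps in `K` and `w` in
a given coset `W_K v`: one takes `y` of minimal length. -/
theorem exists_standardFace_comp_eq (K : Finset (Fin n)) (u v : HyperoctahedralGroup n) :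
    ∃ w : HyperoctahedralGroup n, standardFace K ∘ w.1 = standardFace K ∘ v.1 ∧
      ∀ j ∈ K, (u * w⁻¹).1 (stepBot j) < (u * w⁻¹).1 (stepTop j) := by
  obtain ⟨w, hw, hmin⟩ := Set.exists_min_image
    {w : HyperoctahedralGroup n | standardFace K ∘ w.1 = standardFace K ∘ v.1}
    (fun w => wordLength (simpleB n) (u * w⁻¹)) (Set.toFinite _) ⟨v, rfl⟩
  refine ⟨w, hw, fun j hj => ?_⟩
  by_contra hc
  have hlt : (u * w⁻¹).1 (stepTop j) < (u * w⁻¹).1 (stepBot j) :=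
    (not_lt.mp hc).lt_of_ne fun e => (stepBot_lt_stepTop j).ne' ((u * w⁻¹).1.injective e)
  have h := hmin (simpleB n j * w) (by
    refine Eq.trans ?_ hw
    funext x
    exact standardFace_simpleB hj _)
  have hinv : (simpleB n j)⁻¹ = simpleB n j := inv_eq_of_mul_eq_one_left (simpleB_mul_self j)
  rw [mul_inv_rev, hinv, ← mul_assoc] at h
  exact h.not_gt (wordLength_mul_lt_of_descent hlt)

/-- The multiplication rule of the descent algebra, in the form it takes in the face semigroup:
`x_K x_J` is the sum of `x_L` over the products of the standard face of type `J` with the compatible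
faces of type `K`, where `L` is the type of the product. -/
theorem descentElt_mul (F : Type u) [Field F] (K J : Finset (Fin n)) :
    descentElt F (simpleB n) K * descentElt F (simpleB n) J =
      ∑ g ∈ compatibleFaces K J, descentElt F (simpleB n) (flatSteps J g) := by
  unfold descentElt
  rw [Finset.sum_mul_sum, ← Finset.sum_product', Finset.sum_sigma']
  refine Finset.sum_bij (fun p _ => ⟨standardFace K ∘ p.2.1, p.1 * p.2⟩) ?_ ?_ ?_ ?_
  · rintro ⟨y, w⟩ hp
    rw [Finset.mem_product, mem_toFinset_distinguishedReps, mem_toFinset_distinguishedReps] at hp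
    rw [Finset.mem_sigma, compatibleFaces, Finset.mem_filter, mem_facesOfType,
      mem_toFinset_distinguishedReps]
    refine ⟨⟨⟨w, rfl⟩, fun j hj => standardFace_monotone K (hp.2 j hj).le⟩, fun j hj => ?_⟩
    obtain ⟨hj1, hj2⟩ := Finset.mem_filter.mp hj
    exact lt_of_standardFace_eq hp.1 (hp.2 j hj1) hj2
  · rintro ⟨y, w⟩ hp ⟨y', w'⟩ hp' h
    rw [Finset.mem_product, mem_toFinset_distinguishedReps,
      mem_toFinset_distinguishedReps] at hp hp'
    simp only [Sigma.mk.injEq, heq_eq_eq] at h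
    obtain ⟨rfl, rfl⟩ := eq_of_standardFace_comp_eq hp.1 hp'.1 h.1 h.2
    rfl
  · rintro ⟨g, u⟩ hgu
    rw [Finset.mem_sigma, compatibleFaces, Finset.mem_filter, mem_facesOfType,
      mem_toFinset_distinguishedReps] at hgu
    obtain ⟨⟨⟨v, rfl⟩, hg⟩, hu⟩ := hgu
    obtain ⟨w, hw, hK⟩ := exists_standardFace_comp_eq K u v
    simp only at hg hu
    rw [← hw] at hg hu
    have hux : ∀ x, (u * w⁻¹).1 (w.1 x) = u.1 x := fun x =>
      congrArg u.1 (Equiv.symm_apply_apply w.1 x)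
    refine ⟨(u * w⁻¹, w), ?_, ?_⟩
    · rw [Finset.mem_product, mem_toFinset_distinguishedReps, mem_toFinset_distinguishedReps]
      refine ⟨hK, fun j hj => ?_⟩
      by_contra hc
      have hlt : w.1 (stepTop j) < w.1 (stepBot j) :=
        (not_lt.mp hc).lt_of_ne fun e => (stepBot_lt_stepTop j).ne' (w.1.injective e)
      have hf := le_antisymm (hg j hj) (standardFace_monotone K hlt.le)
      have h1 := lt_of_standardFace_eq hK hlt hf.symm
      rw [hux, hux] at h1
      exact h1.not_gt (hu j (Finset.mem_filter.mpr ⟨hj, hf⟩))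
    · simp [hw]
  · rintro ⟨y, w⟩ _
    simp

/-- For each `L` there is an element whose ascents are exactly the steps outside `L`, namely a
longest element of the parabolic subgroup of type `L`. -/
theorem exists_ascents_eq_compl (L : Finset (Fin n)) : ∃ w : HyperoctahedralGroup n,
    ∀ j, w.1 (stepBot j) < w.1 (stepTop j) ↔ j ∉ L := by
  obtain ⟨w, hw, hmax⟩ := Set.exists_max_image
    {w : HyperoctahedralGroup n | standardFace L ∘ w.1 = standardFace L}
    (fun w => wordLength (simpleB n) w) (Set.toFinite _) ⟨1, rfl⟩
  refine ⟨w, fun j => ⟨fun h hj => ?_, fun hj => ?_⟩⟩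
  · have h2 := hmax (w * simpleB n j) (by
      funext x
      exact (congrFun hw _).trans (standardFace_simpleB hj x))
    exact h2.not_gt (wordLength_lt_mul_iff.mpr h)
  · by_contra hc
    have h1 := standardFace_monotone L (not_lt.mp hc)
    have hw' := fun x => congrFun hw x
    simp only [Function.comp_apply] at hw'
    rw [hw', hw'] at h1
    exact h1.not_gt (standardFace_stepBot_lt hj)

open Classical in
theorem descentElt_coeff (F : Type u) [Field F] (J : Finset (Fin n))
    (w : HyperoctahedralGroup n) :
    (descentElt F (simpleB n) J).coeff w =
      if ∀ j ∈ J, w.1 (stepBot j) < w.1 (stepTop j) then 1 else 0 := by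
  rw [descentElt, MonoidAlgebra.coeff_sum, Finsupp.finsetSum_apply]
  simp only [MonoidAlgebra.of_apply, MonoidAlgebra.coeff_single, Finsupp.single_apply]
  rw [Finset.sum_ite_eq' _ w]
  simp only [mem_toFinset_distinguishedReps]

/-- The coefficient of `x_J` at an element with ascent set `L` is `1` if `J ⊆ L` and `0` otherwise,
so the family is unitriangular with respect to inclusion. -/
theorem linearIndependent_descentElt (F : Type u) [Field F] :
    LinearIndependent F (descentElt F (simpleB n)) := by
  classical
  rw [Fintype.linearIndependent_iff]
  intro c hc L
  induction L using Finset.strongInduction with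
  | H L ih =>
    obtain ⟨w, hw⟩ := exists_ascents_eq_compl Lᶜ
    have h := congrArg (fun x => x.coeff w) hc
    simp only [MonoidAlgebra.coeff_sum, MonoidAlgebra.coeff_smul, Finsupp.finsetSum_apply,
      Finsupp.smul_apply, descentElt_coeff, hw, Finset.mem_compl, not_not,
      MonoidAlgebra.coeff_zero, Finsupp.coe_zero, Pi.zero_apply, smul_eq_mul] at h
    rw [Finset.sum_eq_single L] at h
    · simpa using h
    · intro J _ hJ
      by_cases hs : J ⊆ L
      · rw [ih J (hs.ssubset_of_ne hJ), zero_mul]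
      · rw [if_neg fun h => hs fun j hj => h j hj, mul_zero]
    · simp

theorem descentElt_univ (F : Type u) [Field F] :
    descentElt F (simpleB n) Finset.univ = 1 := by
  classical
  have h : (Set.toFinite (distinguishedReps (simpleB n) Finset.univ)).toFinset = {1} := by
    ext w
    rw [mem_toFinset_distinguishedReps, Finset.mem_singleton]
    constructor
    · exact fun h => eq_one_of_forall_ascent fun j => h j (Finset.mem_univ j)
    · rintro rfl j _
      exact stepBot_lt_stepTop j
  rw [descentElt, h, Finset.sum_singleton, map_one]

/-- Central symmetry pairs off the compatible faces of a proper type that are constant along all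
steps in `J`, so in characteristic `2` the coefficient of `x_J` in `x_K x_J` vanishes. -/
theorem sum_compatibleFaces_flat_eq_zero (F : Type u) [Field F] [CharP F 2]
    {K : Finset (Fin n)} (hK : K ≠ Finset.univ) (J : Finset (Fin n)) :
    ∑ g ∈ (compatibleFaces K J).filter (fun g => flatSteps J g = J),
      descentElt F (simpleB n) (flatSteps J g) = 0 := by
  obtain ⟨k, hk⟩ : ∃ k, k ∉ K := by
    by_contra! h
    exact hK (Finset.eq_univ_of_forall h)
  have hmem : ∀ g, g ∈ (compatibleFaces K J).filter (fun g => flatSteps J g = J) →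
      -g ∈ (compatibleFaces K J).filter (fun g => flatSteps J g = J) := by
    intro g hg
    rw [Finset.mem_filter, compatibleFaces, Finset.mem_filter, mem_facesOfType, flatSteps,
      Finset.filter_eq_self] at hg ⊢
    obtain ⟨⟨⟨v, rfl⟩, -⟩, hflat⟩ := hg
    refine ⟨⟨⟨v * ⟨negPerm n, Subgroup.mem_centralizer_singleton_iff.mpr rfl⟩, ?_⟩, ?_⟩, ?_⟩
    · funext x
      change standardFace K (v.1 (negPerm n x)) = -standardFace K (v.1 x)
      rw [hyperoctahedral_neg, standardFace_neg]
    · intro j hj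
      exact (congrArg Neg.neg (hflat j hj)).le
    · intro j hj
      exact congrArg Neg.neg (hflat j hj)
  refine Finset.sum_involution (fun g _ => -g) ?_ ?_ hmem (fun g _ => neg_neg g)
  · intro g hg
    rw [(Finset.mem_filter.mp hg).2, (Finset.mem_filter.mp (hmem g hg)).2, ← two_smul F,
      CharTwo.two_eq_zero, zero_smul]
  · intro g hg _ he
    have hg := (Finset.mem_filter.mp (Finset.mem_filter.mp hg).1).1
    obtain ⟨v, rfl⟩ := mem_facesOfType.mp hg
    have h0 : ∀ x, standardFace K x = 0 := fun x => by
      have h := congrFun he (v.1.symm x)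
      simp only [Pi.neg_apply, Function.comp_apply, Equiv.apply_symm_apply] at h
      omega
    have := standardFace_stepBot_lt hk
    rw [h0, h0] at this
    exact this.false

/-! ### The filtration of the descent algebra -/

/-- The linear span of the `x_J` with `|J| ≤ n - m`. -/
noncomputable def descentFiltration (F : Type u) [Field F] (n m : ℕ) :
    Submodule F (MonoidAlgebra F (HyperoctahedralGroup n)) :=
  Submodule.span F {y | ∃ J : Finset (Fin n), J.card + m ≤ n ∧ y = descentElt F (simpleB n) J}

variable (F : Type u) [Field F]

theorem descentElt_mem_filtration {J : Finset (Fin n)} {m : ℕ} (h : J.card + m ≤ n) :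
    descentElt F (simpleB n) J ∈ descentFiltration F n m :=
  Submodule.subset_span ⟨J, h, rfl⟩

theorem descentFiltration_eq_bot {m : ℕ} (h : n < m) : descentFiltration F n m = ⊥ := by
  rw [descentFiltration, Submodule.span_eq_bot]
  rintro y ⟨J, hJ, -⟩
  omega

variable {F}

theorem descentFiltration_zero_mul {m : ℕ} {a b : MonoidAlgebra F (HyperoctahedralGroup n)}
    (ha : a ∈ descentFiltration F n 0) (hb : b ∈ descentFiltration F n m) :
    a * b ∈ descentFiltration F n m := by
  have h : descentFiltration F n 0 * descentFiltration F n m ≤ descentFiltration F n m := by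
    rw [descentFiltration, descentFiltration, Submodule.span_mul_span, Submodule.span_le]
    rintro _ ⟨_, ⟨K, hK, rfl⟩, _, ⟨J, hJ, rfl⟩, rfl⟩
    simp only [descentElt_mul]
    refine Submodule.sum_mem _ fun g _ => descentElt_mem_filtration F ?_
    have := Finset.card_le_card (flatSteps_subset J g)
    omega
  exact h (Submodule.mul_mem_mul ha hb)

/-- In characteristic `2`, multiplication on the left by an `x_K` with `K` proper moves `x_J` into
the span of the `x_L` with `L` strictly contained in `J`. -/
theorem descentFiltration_one_mul [CharP F 2] {m : ℕ}
    {a b : MonoidAlgebra F (HyperoctahedralGroup n)}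
    (ha : a ∈ descentFiltration F n 1) (hb : b ∈ descentFiltration F n m) :
    a * b ∈ descentFiltration F n (m + 1) := by
  have h : descentFiltration F n 1 * descentFiltration F n m ≤ descentFiltration F n (m + 1) := by
    rw [descentFiltration, descentFiltration, Submodule.span_mul_span, Submodule.span_le]
    rintro _ ⟨_, ⟨K, hK, rfl⟩, _, ⟨J, hJ, rfl⟩, rfl⟩
    have hK' : K ≠ Finset.univ := by
      rintro rfl
      simp at hK
    simp only [descentElt_mul]
    rw [← Finset.sum_filter_add_sum_filter_not _ (fun g => flatSteps J g = J),
      sum_compatibleFaces_flat_eq_zero F hK' J, zero_add]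
    refine Submodule.sum_mem _ fun g hg => descentElt_mem_filtration F ?_
    have := Finset.card_lt_card
      ((flatSteps_subset J g).ssubset_of_ne (Finset.mem_filter.mp hg).2)
    omega
  exact h (Submodule.mul_mem_mul ha hb)

theorem descentAlgebraB_le_filtration {a : MonoidAlgebra F (HyperoctahedralGroup n)}
    (ha : a ∈ descentAlgebraB F n) : a ∈ descentFiltration F n 0 := by
  have hone : (1 : MonoidAlgebra F (HyperoctahedralGroup n)) ∈ descentFiltration F n 0 := by
    rw [← descentElt_univ F]
    exact descentElt_mem_filtration F (by simp)
  induction ha using Algebra.adjoin_induction with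
  | mem x hx =>
    obtain ⟨J, rfl⟩ := hx
    exact descentElt_mem_filtration F (by simpa using J.card_le_univ)
  | algebraMap r =>
    rw [Algebra.algebraMap_eq_smul_one]
    exact Submodule.smul_mem _ _ hone
  | add x y _ _ hx hy => exact add_mem hx hy
  | mul x y _ _ hx hy => exact descentFiltration_zero_mul hx hy

theorem exists_sub_mem_filtration_one {a : MonoidAlgebra F (HyperoctahedralGroup n)}
    (ha : a ∈ descentFiltration F n 0) :
    ∃ c : F, a - algebraMap F _ c ∈ descentFiltration F n 1 := by
  induction ha using Submodule.span_induction with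
  | mem x hx =>
    obtain ⟨J, -, rfl⟩ := hx
    by_cases hJ : J = Finset.univ
    · exact ⟨1, by rw [hJ, descentElt_univ, map_one, sub_self]; exact zero_mem _⟩
    · refine ⟨0, ?_⟩
      rw [map_zero, sub_zero]
      refine descentElt_mem_filtration F ?_
      have := (Finset.card_lt_iff_ne_univ J).mpr hJ
      rw [Fintype.card_fin] at this
      omega
  | zero => exact ⟨0, by simp⟩
  | add x y _ _ hx hy =>
    obtain ⟨c, hc⟩ := hx
    obtain ⟨d, hd⟩ := hy
    refine ⟨c + d, ?_⟩
    rw [map_add, add_sub_add_comm]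
    exact add_mem hc hd
  | smul r x _ hx =>
    obtain ⟨c, hc⟩ := hx
    refine ⟨r * c, ?_⟩
    rw [map_mul, ← Algebra.smul_def, ← smul_sub]
    exact Submodule.smul_mem _ _ hc

theorem pow_mem_descentFiltration [CharP F 2] {a : MonoidAlgebra F (HyperoctahedralGroup n)}
    (ha : a ∈ descentFiltration F n 1) (k : ℕ) : a ^ (k + 1) ∈ descentFiltration F n (k + 1) := by
  induction k with
  | zero => simpa using ha
  | succ k ih => rw [pow_succ']; exact descentFiltration_one_mul ha ih

/-- The coordinate of `x_J` with respect to the linearly independent family of all the `x_K`. -/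
theorem exists_descentElt_coord (F : Type u) [Field F] (J : Finset (Fin n)) :
    ∃ ψ : MonoidAlgebra F (HyperoctahedralGroup n) →ₗ[F] F,
      ψ (descentElt F (simpleB n) J) = 1 ∧
      ∀ K, K ≠ J → ψ (descentElt F (simpleB n) K) = 0 := by
  obtain ⟨g, hg⟩ := LinearMap.exists_leftInverse_of_injective
    (Finsupp.linearCombination F (descentElt F (simpleB n)))
    (LinearMap.ker_eq_bot.mpr (linearIndependent_descentElt F))
  have hgx : ∀ K, g (descentElt F (simpleB n) K) = Finsupp.single K 1 := fun K => by
    simpa using congrArg (fun f => f (Finsupp.single K 1)) hg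
  refine ⟨Finsupp.lapply J ∘ₗ g, ?_, fun K hK => ?_⟩
  · simp [hgx]
  · simp [hgx, hK]

end Faces

/-! ### Algebras with a nil left ideal of codimension one -/

section LocalAlgebra

variable {F : Type u} [Field F] {A : Type u} [Ring A] [Algebra F A] {I : Ideal A}

/-- If `A = F + I` with `I` a nil left ideal, then `I` is the only maximal left ideal. -/
theorem eq_of_isMaximal_of_nil (hnil : ∀ a ∈ I, IsNilpotent a)
    (hdec : ∀ a, ∃ c : F, a - algebraMap F A c ∈ I) (M : Ideal A) [hM : M.IsMaximal] : M = I := by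
  have hIM : I ≤ M := by
    by_contra h
    have htop : M ⊔ I = ⊤ := hM.out.2 _ (left_lt_sup.mpr h)
    obtain ⟨m, hm, i, hi, e⟩ := Submodule.mem_sup.mp (htop ▸ Submodule.mem_top : (1 : A) ∈ M ⊔ I)
    have hu : IsUnit m := by
      rw [eq_sub_of_add_eq e]
      exact (hnil i hi).isUnit_one_sub
    exact hM.ne_top (Ideal.eq_top_of_isUnit_mem _ hm hu)
  refine le_antisymm (fun a ha => ?_) hIM
  obtain ⟨c, hc⟩ := hdec a
  have hcM : algebraMap F A c ∈ M := by
    have := M.sub_mem ha (hIM hc)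
    rwa [sub_sub_cancel] at this
  have hc0 : c = 0 := by
    by_contra h0
    exact hM.ne_top (Ideal.eq_top_of_isUnit_mem _ hcM ((IsUnit.mk0 c h0).map _))
  rwa [hc0, map_zero, sub_zero] at hc

/-- All simple modules are isomorphic to the quotient by the only maximal left ideal. -/
theorem card_extQuiver_eq_one [Nontrivial A] (hnil : ∀ a ∈ I, IsNilpotent a)
    (hdec : ∀ a, ∃ c : F, a - algebraMap F A c ∈ I) : Nat.card (ExtQuiver F A) = 1 := by
  obtain ⟨M, hM⟩ := Ideal.exists_maximal A
  have hMI := eq_of_isMaximal_of_nil hnil hdec M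
  subst hMI
  rw [Nat.card_eq_one_iff_unique]
  constructor
  · constructor
    rintro ⟨X, hX⟩ ⟨Y, hY⟩
    refine Quotient.sound ?_
    obtain ⟨P, hP, ⟨e⟩⟩ := isSimpleModule_iff_quot_maximal.mp hX
    obtain ⟨Q, hQ, ⟨f⟩⟩ := isSimpleModule_iff_quot_maximal.mp hY
    have h1 := eq_of_isMaximal_of_nil hnil hdec P
    have h2 := eq_of_isMaximal_of_nil hnil hdec Q
    subst h1
    subst h2
    exact ⟨e.trans f.symm⟩
  · exact ⟨Quotient.mk _ ⟨ModuleCat.of A (A ⧸ M), isSimpleModule_iff_isCoatom.mpr hM.out⟩⟩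

/-- The map `Hom_A(I, S) → Ext¹_A(A / I, S)` is onto since `A` is projective, and injective if
every map `A → S` vanishes on `I`. -/
theorem extClass_comp_bijective {S : ShortComplex (ModuleCat.{u} A)} (hS : S.ShortExact)
    [Projective S.X₂] (Y : ModuleCat.{u} A) (h0 : ∀ f : S.X₂ ⟶ Y, S.f ≫ f = 0) :
    Function.Bijective fun f : S.X₁ ⟶ Y =>
      hS.extClass.comp (Abelian.Ext.mk₀ f) (add_zero 1) := by
  constructor
  · intro f g hfg
    rw [← sub_eq_zero] at hfg ⊢
    have h1 : hS.extClass.comp (Abelian.Ext.mk₀ (f - g)) (add_zero 1) = 0 := by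
      rw [← hfg, sub_eq_add_neg, Abelian.Ext.mk₀_add, Abelian.Ext.mk₀_neg,
        Abelian.Ext.comp_add, Abelian.Ext.comp_neg, sub_eq_add_neg]
    obtain ⟨x, hx⟩ := Abelian.Ext.contravariant_sequence_exact₁ hS Y _ _ h1
    obtain ⟨k, rfl⟩ := (Abelian.Ext.mk₀_bijective _ _).2 x
    rw [Abelian.Ext.mk₀_comp_mk₀, h0] at hx
    exact ((Abelian.Ext.mk₀_bijective _ _).1 hx).symm
  · intro x
    obtain ⟨y, hy⟩ := Abelian.Ext.contravariant_sequence_exact₃ hS Y x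
      (Abelian.Ext.eq_zero_of_projective _) (add_zero 1)
    obtain ⟨k, rfl⟩ := (Abelian.Ext.mk₀_bijective _ _).2 y
    exact ⟨k, hy⟩

open scoped ModuleCat in
theorem finite_moduleCat_hom [Module.Finite F A] (X Y : ModuleCat.{u} A) [Module.Finite A X]
    [Module.Finite A Y] : Module.Finite F (X ⟶ Y) := by
  have : Module.Finite F X := Module.Finite.trans A X
  have : Module.Finite F Y := Module.Finite.trans A Y
  let r : (X ⟶ Y) →ₗ[F] (X →ₗ[F] Y) :=
    { toFun f := f.hom.restrictScalars F
      map_add' _ _ := rfl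
      map_smul' _ _ := rfl }
  refine Module.Finite.of_injective r fun f g h => ?_
  ext x
  exact congrArg (fun k : X →ₗ[F] Y => k x) h

open scoped ModuleCat in
/-- Functionals on `A` that vanish on `I²` and are independent on `I` give independent elements
of `Hom_A(I, S) ≅ Ext¹_A(S, S)`. -/
theorem card_le_finrank_ext [Module.Finite F A] (hnil : ∀ a ∈ I, IsNilpotent a)
    (hdec : ∀ a, ∃ c : F, a - algebraMap F A c ∈ I) {ι : Type} [Fintype ι] [DecidableEq ι]
    (ψ : ι → A →ₗ[F] F) (hψ : ∀ i, ∀ a ∈ I, ∀ b ∈ I, ψ i (a * b) = 0) (x : ι → A)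
    (hx : ∀ i, x i ∈ I) (hψx : ∀ i j, ψ i (x j) = if i = j then 1 else 0)
    (S : ModuleCat.{u} A) [IsSimpleModule A S] :
    Fintype.card ι ≤ Module.finrank F (Abelian.Ext.{u} S S 1) := by
  have : Nontrivial S := IsSimpleModule.nontrivial A S
  obtain ⟨s, hs⟩ := exists_ne (0 : S)
  have hker : ∀ t : S, t ≠ 0 → LinearMap.ker (LinearMap.toSpanSingleton A S t) = I := fun t ht =>
    have := IsSimpleModule.ker_toSpanSingleton_isMaximal A ht
    eq_of_isMaximal_of_nil hnil hdec _
  -- The annihilator of a nonzero element of a simple module is a maximal left ideal, so it is `I`.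
  have hann : ∀ a ∈ I, ∀ t : S, a • t = 0 := fun a ha t => by
    by_cases ht : t = 0
    · rw [ht, smul_zero]
    · rw [← hker t ht] at ha
      exact ha
  have hcomp : (ModuleCat.ofHom I.subtype : ModuleCat.of A I ⟶ ModuleCat.of A A) ≫
      ModuleCat.ofHom (LinearMap.toSpanSingleton A S s) = 0 := by
    ext a
    exact hann a.1 a.2 s
  let C : ShortComplex (ModuleCat.{u} A) := ShortComplex.mk _ _ hcomp
  have hC : C.ShortExact := by
    refine ModuleCat.shortComplex_shortExact C ?_ Subtype.val_injective
      (IsSimpleModule.toSpanSingleton_surjective A hs)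
    intro a
    constructor
    · intro ha
      exact ⟨⟨a, (hker s hs).le ha⟩, rfl⟩
    · rintro ⟨b, rfl⟩
      exact hann b.1 b.2 s
  have : Projective C.X₂ := inferInstanceAs (Projective (ModuleCat.of A A))
  have hbij := extClass_comp_bijective hC S fun f => by
    ext a
    have : f.hom (a.1 • (1 : A)) = a.1 • f.hom (1 : A) := map_smul f.hom a.1 (1 : A)
    rw [hann a.1 a.2, smul_eq_mul, mul_one] at this
    exact this
  let δ : (C.X₁ ⟶ S) →ₗ[F] Abelian.Ext.{u} S S 1 :=
    hC.extClass.precompOfLinear F S (add_zero 1) ∘ₗ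
      (Abelian.Ext.linearEquiv₀ (R := F)).symm.toLinearMap
  have hδ : Function.Bijective δ := hbij
  have : IsNoetherian F A := inferInstance
  have : IsNoetherian A A := isNoetherian_of_tower F this
  have : Module.Finite A C.X₁ := inferInstanceAs (Module.Finite A I)
  have : Module.Finite F (C.X₁ ⟶ S) := finite_moduleCat_hom _ _
  have : Module.Finite F (Abelian.Ext.{u} S S 1) := Module.Finite.of_surjective δ hδ.2
  -- As `ψ i` vanishes on `I²` and `I` annihilates `S`, only the scalar part of `a` matters here.
  have hmul : ∀ i (a b : A), b ∈ I → ψ i (a * b) • s = a • (ψ i b • s) := fun i a b hb => by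
    obtain ⟨c, hc⟩ := hdec a
    have e : a = algebraMap F A c + (a - algebraMap F A c) := by abel
    rw [e, add_mul, map_add, hψ i _ hc b hb, add_zero, add_smul, hann _ hc, add_zero,
      ← Algebra.smul_def, map_smul, smul_eq_mul, mul_smul, algebraMap_smul]
  let φ : ι → (C.X₁ ⟶ S) := fun i => ModuleCat.ofHom
    { toFun := fun a : I => ψ i a.1 • s
      map_add' := fun a b => by rw [Submodule.coe_add, map_add, add_smul]
      map_smul' := fun a b => hmul i a b.1 b.2 }
  have hφ : LinearIndependent F φ := by
    rw [Fintype.linearIndependent_iff]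
    intro c hc j
    let ev : (C.X₁ ⟶ S) →ₗ[F] S :=
      { toFun := fun f => f.hom (⟨x j, hx j⟩ : I)
        map_add' _ _ := rfl
        map_smul' _ _ := rfl }
    have h1 := congrArg ev hc
    have h2 : ∀ i, ev (φ i) = ψ i (x j) • s := fun _ => rfl
    simp only [map_sum, map_smul, h2, hψx, map_zero, ite_smul, one_smul, zero_smul,
      smul_ite, smul_zero, Finset.sum_ite_eq', Finset.mem_univ, if_true] at h1
    exact (smul_eq_zero.mp h1).resolve_right hs
  exact (hφ.map' δ (LinearMap.ker_eq_bot.mpr hδ.1)).fintype_card_le_finrank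

end LocalAlgebra

/-! ### The radical of the descent algebra -/

/-- The left ideal of the descent algebra of type `B` spanned by the `x_J` with `J` a proper
subset of the set of generators. In characteristic `2` it is the only maximal left ideal. -/
def properIdeal (F : Type u) [Field F] (n : ℕ) : Ideal (descentAlgebraB F n) where
  carrier := {a | a.1 ∈ descentFiltration F n 1}
  add_mem' ha hb := (descentFiltration F n 1).add_mem ha hb
  zero_mem' := (descentFiltration F n 1).zero_mem
  smul_mem' a _ hb := descentFiltration_zero_mul (descentAlgebraB_le_filtration a.2) hb

section Radical

variable {F : Type u} [Field F] {n : ℕ}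

theorem mem_properIdeal {a : descentAlgebraB F n} :
    a ∈ properIdeal F n ↔ a.1 ∈ descentFiltration F n 1 := Iff.rfl

theorem isNilpotent_of_mem_properIdeal [CharP F 2] {a : descentAlgebraB F n}
    (ha : a ∈ properIdeal F n) : IsNilpotent a := by
  refine ⟨n + 1, Subtype.ext ?_⟩
  have h := pow_mem_descentFiltration (mem_properIdeal.mp ha) n
  rw [descentFiltration_eq_bot F n.lt_succ_self, Submodule.mem_bot] at h
  exact h

theorem exists_sub_mem_properIdeal (a : descentAlgebraB F n) :
    ∃ c : F, a - algebraMap F (descentAlgebraB F n) c ∈ properIdeal F n :=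
  exists_sub_mem_filtration_one (descentAlgebraB_le_filtration a.2)

theorem eq_properIdeal_of_isMaximal [CharP F 2] (M : Ideal (descentAlgebraB F n))
    [M.IsMaximal] : M = properIdeal F n :=
  eq_of_isMaximal_of_nil (F := F) (fun a ha => isNilpotent_of_mem_properIdeal (a := a) ha)
    (fun a => exists_sub_mem_properIdeal a) M

theorem jacobson_le_properIdeal [CharP F 2] :
    Ring.jacobson (descentAlgebraB F n) ≤ properIdeal F n := by
  obtain ⟨M, hM⟩ := Ideal.exists_maximal (descentAlgebraB F n)
  have h := eq_properIdeal_of_isMaximal M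
  intro a ha
  rw [← h]
  exact Ring.jacobson_le_of_isMaximal M ha

theorem jacobson_pow_mem_filtration [CharP F 2] (m : ℕ) {x : descentAlgebraB F n}
    (hx : x ∈ Ring.jacobson (descentAlgebraB F n) ^ m) : x.1 ∈ descentFiltration F n m := by
  induction m generalizing x with
  | zero => exact descentAlgebraB_le_filtration x.2
  | succ m ih =>
    -- For a left ideal `I`, the product `I * I ^ 0 = I * ⊤` need not be `I ^ 1 = I`.
    rcases eq_or_ne m 0 with rfl | hm
    · rw [Submodule.pow_one] at hx
      exact jacobson_le_properIdeal hx
    rw [Submodule.pow_succ' _ hm] at hx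
    induction hx using Submodule.mul_induction_on' with
    | mem_mul_mem a ha b hb => exact descentFiltration_one_mul (jacobson_le_properIdeal ha) (ih hb)
    | add a _ b _ ha hb => exact (descentFiltration F n (m + 1)).add_mem ha hb

/-- The `n` elements `x_J` with `|J| = n - 1` are independent modulo the square of the radical,
which gives one loop for each of them. -/
theorem le_finrank_ext_descentAlgebraB [CharP F 2] (S : ModuleCat.{u} (descentAlgebraB F n))
    [IsSimpleModule (descentAlgebraB F n) S] :
    n ≤ Module.finrank F (Abelian.Ext.{u} S S 1) := by
  have hcard : ∀ i : Fin n, (Finset.univ.erase i).card + 1 = n := fun i => by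
    have hi := i.2
    rw [Finset.card_erase_of_mem (Finset.mem_univ i), Finset.card_univ, Fintype.card_fin]
    omega
  choose ψ hψ1 hψ0 using fun i : Fin n => exists_descentElt_coord F (Finset.univ.erase i)
  have h := card_le_finrank_ext (F := F) (I := properIdeal F n)
    (fun a ha => isNilpotent_of_mem_properIdeal (a := a) ha)
    (fun a => exists_sub_mem_properIdeal a)
    (fun i => ψ i ∘ₗ (descentAlgebraB F n).val.toLinearMap) ?_
    (fun i => ⟨descentElt F (simpleB n) (Finset.univ.erase i),
      Algebra.subset_adjoin ⟨_, rfl⟩⟩)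
    (fun i => descentElt_mem_filtration F (hcard i).le) ?_ S
  · rwa [Fintype.card_fin] at h
  · intro i a ha b hb
    have hab : a.1 * b.1 ∈ descentFiltration F n (1 + 1) := descentFiltration_one_mul ha hb
    have hle : descentFiltration F n (1 + 1) ≤ LinearMap.ker (ψ i) := by
      rw [descentFiltration, Submodule.span_le]
      rintro _ ⟨J, hJ, rfl⟩
      refine hψ0 i J ?_
      rintro rfl
      have := hcard i
      omega
    exact hle hab
  · intro i j
    change ψ i (descentElt F (simpleB n) (Finset.univ.erase j)) = _
    split_ifs with hij
    · rw [hij, hψ1]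
    · refine hψ0 i _ fun e => hij ?_
      have hj : i ∉ Finset.univ.erase j := e ▸ Finset.notMem_erase i _
      simpa using hj

end Radical

theorem lemma4p3 (F : Type u) [Field F] [CharP F 2] (n : ℕ) :
    (Nat.card (ExtQuiver F (descentAlgebraB F n)) = 1 ∧
      ∀ v : ExtQuiver F (descentAlgebraB F n), n ≤ Nat.card (v ⟶ v)) ∧
    ∀ (m : ℕ) (x : descentAlgebraB F n), x ∈ Ring.jacobson (descentAlgebraB F n) ^ m →
      (x : MonoidAlgebra F (HyperoctahedralGroup n)) ∈
        Submodule.span F {y | ∃ J : Finset (Fin n), J.card + m ≤ n ∧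
          y = descentElt F (simpleB n) J} := by
  refine ⟨⟨card_extQuiver_eq_one
    (fun a ha => isNilpotent_of_mem_properIdeal (a := a) ha)
    (fun a => exists_sub_mem_properIdeal a), fun v => ?_⟩,
    fun m x hx => jacobson_pow_mem_filtration m hx⟩
  have : IsSimpleModule (descentAlgebraB F n) v.simple := (Quotient.out v).2
  change n ≤ Nat.card (Fin (Module.finrank F (Abelian.Ext.{u} v.simple v.simple 1)))
  rw [Nat.card_fin]
  exact le_finrank_ext_descentAlgebraB v.simple
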